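/- Let $g,\ell,\nu$ be positive integers and $d\ge 0$ an integer. Let $\mathbb R\langle x\rangle$ be the free algebra in noncommuting variables $x=(x_1,\dots,x_g)$, with the involution ${}^*$ that fixes $\mathbb R$ and each $x_j$ and reverses products, extended to matrices over $\mathbb R\langle x\rangle$ by $(P^*)_{ij}=(P_{ji})^*$. Let $\mathbb R\langle x\rangle_k$ be the space of polynomials of degree at most $k$; a matrix over $\mathbb R\langle x\rangle$ has degree at most $k$ if all its entries lie in $\mathbb R\langle x\rangle_k$. Evaluate matrices over $\mathbb R\langle x\rangle$ entrywise at $g$-tuples of real $n\times n$ matrices. Let $q=I_\ell-\sum_{j=1}^g A_jx_j$ be a monic linear pencil, where $A_1,\dots,A_g$ are real symmetric $\ell\times\ell$ matrices. For $n\ge 1$ let $\mathfrak P_q(n)$ be the set of $g$-tuples $X$ of real symmetric $n\times n$ matrices with $q(X)\succeq 0$, and $\mathfrak P_q=\bigcup_n\mathfrak P_q(n)$. Then: 1. If $p=p^*$ is a $\nu\times\nu$ matrix over $\mathbb R\langle x\rangle$ of degree at most $2d+1$ and $p(X)\succeq 0$ for all $X\in\mathfrak P_q$, then $p\in M^\nu_{d+1,d}(q)$,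 i.e. $$p=\sum_i s_i^*s_i+\sum_i f_i^*\,q\,f_i$$ (finite sums) for some $\nu\times\nu$ matrices $s_i$ over $\mathbb R\langle x\rangle$ of degree at most $d+1$ and some $\ell\times\nu$ matrices $f_i$ over $\mathbb R\langle x\rangle$ of degree at most $d$. 2. There is a smallest positive integer $t$ such that for every $\nu\times\nu$ matrix $p=p^*$ over $\mathbb R\langle x\rangle$ of degree at most $2d+2$ one has: $p(X)\succeq 0$ for all $X\in\mathfrak P_q$ if and only if $p(X)\succeq 0$ for all $X\in\mathfrak P_q(t)$. This $t$ satisfies $t\le \nu\cdot\dim\mathbb R\langle x\rangle_{d+1}$. -/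

import Mathlib

namespace NCPoly

open scoped Matrix

/-- `ℝ⟨x⟩`: real polynomials in the noncommuting variables `x₁, …, x_g`. Its `star` (from Mathlib)
is the involution that fixes the scalars and the variables and reverses products. -/
abbrev NC (g : ℕ) : Type := FreeAlgebra ℝ (Fin g)

/-- The word with the given list of letters, as an element of `ℝ⟨x⟩`. -/
def word {g : ℕ} (w : List (Fin g)) : NC g := (w.map (FreeAlgebra.ι ℝ)).prod

/-- `ℝ⟨x⟩_k`: the space of nc polynomials of degree at most `k`. -/
def degLE (g k : ℕ) : Submodule ℝ (NC g) :=
  Submodule.span ℝ {f | ∃ w : List (Fin g), w.length ≤ k ∧ f = word w}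

/-- `ℝ^{l×m}⟨x⟩`: the `l × m` matrices over `ℝ⟨x⟩`. The conjugate transpose `Pᴴ` is the
involution `P ↦ P^*`, and symmetric elements are those with `P.IsHermitian`. -/
abbrev MatNC (g l m : ℕ) : Type := Matrix (Fin l) (Fin m) (NC g)

/-- The matrix-valued nc polynomial `P` has degree at most `k`. -/
def HasDegLE {g l m : ℕ} (k : ℕ) (P : MatNC g l m) : Prop :=
  ∀ i j, P i j ∈ degLE g k

/-- Entrywise evaluation of `P` at a tuple of `n × n` matrices, as an `ln × mn` matrix. -/
def evalAt {g l m n : ℕ} (P : MatNC g l m) (X : Fin g → Matrix (Fin n) (Fin n) ℝ) :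
    Matrix (Fin l × Fin n) (Fin m × Fin n) ℝ :=
  Matrix.of fun a b => FreeAlgebra.lift ℝ X (P a.1 b.1) a.2 b.2

/-- The pencil `I - ∑ A_j x_j`. -/
noncomputable def monicPencil {g l : ℕ} (A : Fin g → Matrix (Fin l) (Fin l) ℝ) : MatNC g l l :=
  1 - ∑ j, (A j).map fun a => a • FreeAlgebra.ι ℝ j

/-- `q` is a monic linear pencil: `q = I - ∑ A_j x_j` with symmetric real matrices `A_j`. -/
def IsMonicLinearPencil {g l : ℕ} (q : MatNC g l l) : Prop :=
  ∃ A : Fin g → Matrix (Fin l) (Fin l) ℝ, (∀ j, (A j).IsSymm) ∧ q = monicPencil A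

/-- `𝔓_q(n)`: tuples of symmetric `n × n` matrices at which `q` is positive semidefinite. -/
def posSet {g l : ℕ} (q : MatNC g l l) (n : ℕ) : Set (Fin g → Matrix (Fin n) (Fin n) ℝ) :=
  {X | (∀ j, (X j).IsSymm) ∧ (evalAt q X).PosSemidef}

/-- `p` is positive semidefinite on `𝔓_q(n)`. -/
def PsdOnLevel {g l m : ℕ} (q : MatNC g l l) (p : MatNC g m m) (n : ℕ) : Prop :=
  ∀ X ∈ posSet q n, (evalAt p X).PosSemidef

/-- `p` is positive semidefinite on `𝔓_q`, the union of all `𝔓_q(n)`. -/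
def PsdOn {g l m : ℕ} (q : MatNC g l l) (p : MatNC g m m) : Prop :=
  ∀ n : ℕ, PsdOnLevel q p n

/-- `Σ_N^m`: finite sums of squares `s^* s` with `s` of size `m × m` and degree at most `N`. -/
def sosCone (g m N : ℕ) : Set (MatNC g m m) :=
  {p | ∃ (r : ℕ) (s : Fin r → MatNC g m m), (∀ i, HasDegLE N (s i)) ∧ p = ∑ i, (s i)ᴴ * s i}

/-- Finite sums of `f^* q f` with `f` of size `l × m` and degree at most `β`. -/
def weightedCone {g l : ℕ} (q : MatNC g l l) (m β : ℕ) : Set (MatNC g m m) :=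
  {p | ∃ (r : ℕ) (f : Fin r → MatNC g l m), (∀ i, HasDegLE β (f i)) ∧ p = ∑ i, (f i)ᴴ * q * f i}

/-- The truncated quadratic module `M_{α,β}^m(q)`. -/
def truncQM {g l : ℕ} (q : MatNC g l l) (m α β : ℕ) : Set (MatNC g m m) :=
  {p | ∃ s ∈ sosCone g m α, ∃ f ∈ weightedCone q m β, p = s + f}

/-- The `θ`-PosSs-property of `M_{α,β}^m(q)`. -/
def HasPosSs {g l : ℕ} (q : MatNC g l l) (m α β θ : ℕ) : Prop :=
  ∀ p : MatNC g m m, p.IsHermitian → HasDegLE θ p → PsdOn q p → p ∈ truncQM q m α β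

/-- Positivity on `𝔓_q` of symmetric `m × m` nc polynomials of degree at most `k` can be tested on
`𝔓_q(t)`. -/
def IsTestSize {g l : ℕ} (q : MatNC g l l) (k m t : ℕ) : Prop :=
  ∀ p : MatNC g m m, p.IsHermitian → HasDegLE k p → (PsdOn q p ↔ PsdOnLevel q p t)

/-- `t` is the `(k,m)`-test rank of `𝔓_q`: the smallest positive integer that is a test size. -/
def IsTestRank {g l : ℕ} (q : MatNC g l l) (k m t : ℕ) : Prop :=
  IsLeast {t : ℕ | 0 < t ∧ IsTestSize q k m t} t

end NCPoly

namespace NCPoly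

open scoped Matrix

/-! Both claims rest on a truncated GNS construction (`exists_evalForm_eq`). Let `L` be a symmetric
functional that is strictly positive on nonzero squares `s^* s` and nonnegative on all `f^* q f`,
for `s`, `f` of degree at most `k`. Then `⟨u, v⟩ = L(u^* v)` is an inner product on rows of degree
at most `k`, and compressing multiplication by `x_j` to this space gives symmetric matrices `Y_j`.
Since `q` is affine linear, `q(Y)` is the compression of `q`, so `q(Y) ⪰ 0`. Splitting a word into
parts of length at most `k` and `k + 1` shows that `Y` reproduces `L` up to degree `2k + 1`; no flat
extension is needed.

For the Positivstellensatz, a `p` outside the cone is separated from it by such an `L` with `L p <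
0` (`exists_separating_of_forall_ne_sum`), and GNS with `k = d` yields a point of `𝔓_q` where `p` is
not positive semidefinite. For the test rank, a negative value of `p` at some `X` is itself such a
functional after a small perturbation, and GNS with `k = d + 1` moves it to level `m * dim`.

Strict positivity, for closedness of the cone and for GNS without a quotient, comes from the vacuum
state at small Fock-space matrices (`exists_strictlyPositive`). -/

/-! ### Convex separation from cones of sums of squares. -/

open scoped Matrix.Norms.L2Operator MatrixOrder in
theorem _root_.Matrix.PosSemidef.exists_eq_conjTranspose_mul_self {n : Type*} [Fintype n]
    [DecidableEq n] {G : Matrix n n ℝ} (hG : G.PosSemidef) : ∃ R : Matrix n n ℝ, G = Rᴴ * R :=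
  CStarAlgebra.nonneg_iff_eq_star_mul_self.mp hG.nonneg

/-- This is the image of the Frobenius unit sphere under `R ↦ Rᴴ * R`. It serves as a compact base
of the positive semidefinite cone. -/
theorem isCompact_posSemidef_trace_eq_one (N : ℕ) :
    IsCompact {G : Matrix (Fin N) (Fin N) ℝ | G.PosSemidef ∧ G.trace = 1} := by
  have htr : ∀ R : Matrix (Fin N) (Fin N) ℝ, (Rᴴ * R).trace = ∑ i, ∑ j, R j i ^ 2 := by
    intro R
    simp [Matrix.trace, Matrix.mul_apply, sq]
  have hS : IsCompact {R : Matrix (Fin N) (Fin N) ℝ | ∑ i, ∑ j, R j i ^ 2 = 1} := by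
    have hbox : IsCompact (Set.pi Set.univ fun _ : Fin N =>
        Set.pi Set.univ fun _ : Fin N => Set.Icc (-1 : ℝ) 1) :=
      isCompact_univ_pi fun _ => isCompact_univ_pi fun _ => isCompact_Icc
    refine hbox.of_isClosed_subset (isClosed_eq ?_ continuous_const) ?_
    · exact continuous_finsetSum _ fun i _ => continuous_finsetSum _ fun j _ =>
        (continuous_apply_apply j i).pow 2
    · intro R hR j _ i _
      have h1 : R j i ^ 2 ≤ 1 := by
        rw [← (show ∑ i, ∑ j, R j i ^ 2 = 1 from hR)]
        exact (Finset.single_le_sum (f := fun j => R j i ^ 2) (fun _ _ => sq_nonneg _)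
          (Finset.mem_univ j)).trans
          (Finset.single_le_sum (f := fun i => ∑ j, R j i ^ 2)
            (fun _ _ => Finset.sum_nonneg fun _ _ => sq_nonneg _) (Finset.mem_univ i))
      exact abs_le.mp (abs_le_one_iff_mul_self_le_one.mpr (by rwa [← sq]))
  have hcont : Continuous fun R : Matrix (Fin N) (Fin N) ℝ => Rᴴ * R := by fun_prop
  convert hS.image hcont using 1
  ext G
  constructor
  · rintro ⟨hG, h1⟩
    obtain ⟨R, rfl⟩ := hG.exists_eq_conjTranspose_mul_self
    exact ⟨R, by rw [← h1]; exact (htr R).symm, rfl⟩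
  · rintro ⟨R, hR, rfl⟩
    exact ⟨Matrix.posSemidef_conjTranspose_mul_self R, (htr R).trans hR⟩

/-- A point outside the image of the positive semidefinite cone under a linear map which is
injective at the origin of this cone is strictly separated from the image. -/
theorem exists_separating_posSemidef_image {V : Type*} [NormedAddCommGroup V] [NormedSpace ℝ V]
    {N : ℕ} (Φ : Matrix (Fin N) (Fin N) ℝ →ₗ[ℝ] V)
    (h0 : ∀ G, G.PosSemidef → Φ G = 0 → G = 0) (p : V) (hp : ∀ G, G.PosSemidef → Φ G ≠ p) :
    ∃ L : V →ₗ[ℝ] ℝ, L p < 0 ∧ ∀ G, G.PosSemidef → G ≠ 0 → 0 < L (Φ G) := by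
  have hp0 : p ≠ 0 := fun h => hp 0 Matrix.PosSemidef.zero (by simp [h])
  have hΦ : Continuous Φ := Φ.continuous_of_finiteDimensional
  set D := {G : Matrix (Fin N) (Fin N) ℝ | G.PosSemidef ∧ G.trace = 1}
  have hDc : IsCompact (Φ '' D) := (isCompact_posSemidef_trace_eq_one N).image hΦ
  have hDconv : Convex ℝ (Φ '' D) := by
    refine Convex.linear_image ?_ Φ
    rintro G ⟨hG, hG1⟩ H ⟨hH, hH1⟩ a b ha hb hab
    exact ⟨(hG.smul ha).add (hH.smul hb), by simp [Matrix.trace_add, Matrix.trace_smul, hG1, hH1, hab]⟩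
  have hRc : IsClosed ((fun t : ℝ => t • p) '' Set.Ici 0) :=
    (isClosedEmbedding_smul_left hp0).isClosedMap _ isClosed_Ici
  have hRconv : Convex ℝ ((fun t : ℝ => t • p) '' Set.Ici 0) :=
    (convex_Ici (0 : ℝ)).linear_image (LinearMap.toSpanSingleton ℝ V p)
  -- A common point at `t = 0` contradicts injectivity at the origin; one at `t > 0` rescales to a
  -- preimage of `p`.
  have hdisj : Disjoint (Φ '' D) ((fun t : ℝ => t • p) '' Set.Ici 0) := by
    rw [Set.disjoint_left]
    rintro _ ⟨G, ⟨hG, hG1⟩, rfl⟩ ⟨t, ht, htp⟩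
    rcases (show (0 : ℝ) ≤ t from ht).eq_or_lt with rfl | ht
    · have : G = 0 := h0 G hG (by simpa using htp.symm)
      simp [this] at hG1
    · refine hp (t⁻¹ • G) (hG.smul (inv_nonneg.mpr ht.le)) ?_
      rw [map_smul, ← htp]
      simp [smul_smul, ht.ne']
  obtain ⟨f, u, v, hf, huv, hv⟩ :=
    geometric_hahn_banach_compact_closed hDconv hDc hRconv hRc hdisj
  have hv0 : v < 0 := by simpa using hv 0 ⟨0, by simp⟩
  have hfp : 0 ≤ f p := by
    by_contra! h
    have := hv ((v / f p) • p) ⟨v / f p, div_nonneg_of_nonpos hv0.le h.le, rfl⟩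
    rw [map_smul, smul_eq_mul, div_mul_cancel₀ _ h.ne] at this
    exact lt_irrefl _ this
  -- So far `-f` is only known to be `≤ 0` at `p`. Subtracting `δ • φ` makes this strict, and `δ *
  -- |b| < -u` keeps positivity on `Φ '' D`.
  obtain ⟨φ, hφ⟩ := SeparatingDual.exists_eq_one (R := ℝ) hp0
  obtain ⟨b, hb⟩ := hDc.bddAbove_image φ.continuous.continuousOn
  set δ := -u / (|b| + 1)
  have hδ : 0 < δ := div_pos (by linarith) (by positivity)
  have hδb : δ * (|b| + 1) = -u := div_mul_cancel₀ _ (by positivity)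
  refine ⟨(-f - δ • φ : StrongDual ℝ V), by simp [hφ]; linarith, fun G hG hG0 => ?_⟩
  have htr : 0 < G.trace :=
    lt_of_le_of_ne hG.trace_nonneg fun h => hG0 (hG.trace_eq_zero_iff.mp h.symm)
  have hmem : Φ (G.trace⁻¹ • G) ∈ Φ '' D :=
    ⟨_, ⟨hG.smul (inv_nonneg.mpr htr.le), by simp [Matrix.trace_smul, htr.ne']⟩, rfl⟩
  have h1 := hf _ hmem
  have h2 : φ (Φ (G.trace⁻¹ • G)) ≤ |b| := (hb ⟨_, hmem, rfl⟩).trans (le_abs_self b)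
  have h3 : 0 < (-f - δ • φ : StrongDual ℝ V) (Φ (G.trace⁻¹ • G)) := by
    simp only [sub_apply, neg_apply,
      smul_apply, smul_eq_mul] at *
    nlinarith
  have h4 : (-f - δ • φ : StrongDual ℝ V) (Φ G)
      = G.trace * (-f - δ • φ : StrongDual ℝ V) (Φ (G.trace⁻¹ • G)) := by
    rw [map_smul, map_smul, smul_eq_mul, mul_inv_cancel_left₀ htr.ne']
  simpa only [ContinuousLinearMap.coe_coe, h4] using mul_pos htr h3

/-- A vector which is not a sum of squares `B f f` is strictly separated from the squares, provided
that some functional is strictly positive on the squares. -/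
theorem exists_separating_of_forall_ne_sum {F V : Type*} [AddCommGroup F] [Module ℝ F]
    [FiniteDimensional ℝ F] [AddCommGroup V] [Module ℝ V] (B : F →ₗ[ℝ] F →ₗ[ℝ] V)
    (Λ : V →ₗ[ℝ] ℝ) (hΛ : ∀ f, f ≠ 0 → 0 < Λ (B f f)) (p : V)
    (hp : ∀ R : Fin (Module.finrank ℝ F) → F, p ≠ ∑ k, B (R k) (R k)) :
    ∃ L : V →ₗ[ℝ] ℝ, L p < 0 ∧ ∀ f, f ≠ 0 → 0 < L (B f f) := by
  set N := Module.finrank ℝ F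
  let e := Module.finBasis ℝ F
  -- Gram matrix parametrization: sums of squares are the images of positive semidefinite `G`, and
  -- factoring `G = Rᴴ * R` shows that `N` squares suffice.
  let Φ : Matrix (Fin N) (Fin N) ℝ →ₗ[ℝ] V :=
    ∑ i, ∑ j, (Matrix.entryLinearMap ℝ ℝ i j).smulRight (B (e i) (e j))
  have hΦ : ∀ G, Φ G = ∑ i, ∑ j, G i j • B (e i) (e j) := by
    intro G; simp [Φ]
  have hΦR : ∀ R : Matrix (Fin N) (Fin N) ℝ,
      Φ (Rᴴ * R) = ∑ k, B (∑ i, R k i • e i) (∑ i, R k i • e i) := by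
    intro R
    simp only [hΦ, Matrix.mul_apply, map_sum, map_smul, LinearMap.sum_apply, LinearMap.smul_apply,
      Matrix.conjTranspose_apply, star_trivial, Finset.sum_smul, Finset.smul_sum, smul_smul]
    rw [Finset.sum_comm_cycle]
    refine Finset.sum_congr rfl fun k _ => ?_
    rw [Finset.sum_comm]
    exact Finset.sum_congr rfl fun i _ => Finset.sum_congr rfl fun j _ => by rw [mul_comm]
  have hker : ∀ G, G.PosSemidef → Φ G = 0 → G = 0 := by
    intro G hG h
    obtain ⟨R, rfl⟩ := hG.exists_eq_conjTranspose_mul_self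
    have hnn : ∀ f, 0 ≤ Λ (B f f) := fun f => by
      rcases eq_or_ne f 0 with rfl | hf
      · simp
      · exact (hΛ f hf).le
    have h1 : ∑ k, Λ (B (∑ i, R k i • e i) (∑ i, R k i • e i)) = 0 := by
      rw [← map_sum, ← hΦR]; exact (congrArg Λ h).trans (map_zero Λ)
    rw [Finset.sum_eq_zero_iff_of_nonneg fun k _ => hnn _] at h1
    have hR : R = 0 := by
      ext k i
      have h2 : ∑ i, R k i • e i = 0 := by
        by_contra hne
        exact (hΛ _ hne).ne' (h1 k (Finset.mem_univ k))
      exact Fintype.linearIndependent_iff.mp e.linearIndependent _ h2 i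
    simp [hR]
  -- `V` carries no norm and may be infinite dimensional, so separation takes place in coordinates
  -- on `W`, which `T` extends to `V`.
  let W : Submodule ℝ V := LinearMap.range Φ ⊔ ℝ ∙ p
  let c := Module.finBasis ℝ W
  obtain ⟨T, hT⟩ := c.equivFun.toLinearMap.exists_extend
  have hTW : ∀ x ∈ W, ∀ y ∈ W, T x = T y → x = y := by
    intro x hx y hy hxy
    have h1 : ∀ z (hz : z ∈ W), T z = c.equivFun ⟨z, hz⟩ := fun z hz =>
      LinearMap.congr_fun hT ⟨z, hz⟩
    rw [h1 x hx, h1 y hy] at hxy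
    exact congrArg Subtype.val (c.equivFun.injective hxy)
  have hΦW : ∀ G, Φ G ∈ W := fun G => Submodule.mem_sup_left ⟨G, rfl⟩
  have hpW : p ∈ W := Submodule.mem_sup_right (Submodule.mem_span_singleton_self p)
  obtain ⟨L, hLp, hL⟩ := exists_separating_posSemidef_image (T ∘ₗ Φ)
    (fun G hG h => hker G hG (hTW _ (hΦW G) 0 W.zero_mem (by simpa using h))) (T p)
    (fun G hG h => by
      obtain ⟨R, rfl⟩ := hG.exists_eq_conjTranspose_mul_self
      exact hp _ ((hTW _ (hΦW _) p hpW h).symm.trans (hΦR R)))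
  refine ⟨L ∘ₗ T, hLp, fun f hf => ?_⟩
  have h1 : Φ (Matrix.vecMulVec (e.repr f) (e.repr f)) = B f f := by
    conv_rhs => rw [← e.sum_repr f]
    simp only [hΦ, Matrix.vecMulVec_apply, map_sum, map_smul, LinearMap.sum_apply,
      LinearMap.smul_apply, Finset.smul_sum, smul_smul]
    rw [Finset.sum_comm]
    exact Finset.sum_congr rfl fun i _ => Finset.sum_congr rfl fun j _ => by rw [mul_comm]
  have h2 := hL (Matrix.vecMulVec (e.repr f) (e.repr f))
    (by simpa using Matrix.posSemidef_vecMulVec_self_star (e.repr f : Fin N → ℝ))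
    (fun h => hf (by
      have : (e.repr f : Fin N → ℝ) = 0 := by
        ext i
        simpa [Matrix.vecMulVec_apply] using congrFun (congrFun h i) i
      exact e.repr.map_eq_zero_iff.mp (DFunLike.coe_injective this)))
  simpa [h1] using h2

/-! ### Words and the degree filtration. -/

variable {g l m k : ℕ}

theorem word_nil : word ([] : List (Fin g)) = 1 := rfl

theorem word_cons (j : Fin g) (w : List (Fin g)) :
    word (j :: w) = FreeAlgebra.ι ℝ j * word w := by
  simp [word]

theorem word_append (u w : List (Fin g)) : word (u ++ w) = word u * word w := by
  simp [word]

theorem star_word (w : List (Fin g)) : star (word w) = word w.reverse := by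
  induction w with
  | nil => simp [word_nil]
  | cons j w ih => simp [word_cons, word_append, word_nil, ih]

instance : StarModule ℝ (NC g) :=
  ⟨fun c f => by
    rw [Algebra.smul_def, star_mul, FreeAlgebra.star_algebraMap, ← Algebra.commutes,
      ← Algebra.smul_def, star_trivial c]⟩

theorem word_mem_degLE {w : List (Fin g)} (hw : w.length ≤ k) : word w ∈ degLE g k :=
  Submodule.subset_span ⟨w, hw, rfl⟩

theorem degLE_mono {k k' : ℕ} (h : k ≤ k') : degLE g k ≤ degLE g k' :=
  Submodule.span_mono fun _ ⟨w, hw, hf⟩ => ⟨w, hw.trans h, hf⟩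

theorem HasDegLE.mono {k k' : ℕ} (h : k ≤ k') {P : MatNC g l m} (hP : HasDegLE k P) :
    HasDegLE k' P := fun i j => degLE_mono h (hP i j)

noncomputable instance : Fintype {w : List (Fin g) // w.length ≤ k} :=
  (List.finite_length_le _ k).fintype

/-- Elements of `degLE g k` are the linear combinations of the words of length at most `k`. -/
theorem mem_degLE_iff {f : NC g} :
    f ∈ degLE g k ↔ ∃ c : {w : List (Fin g) // w.length ≤ k} → ℝ, ∑ w, c w • word w.1 = f := by
  have : {f : NC g | ∃ w : List (Fin g), w.length ≤ k ∧ f = word w}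
      = Set.range fun w : {w : List (Fin g) // w.length ≤ k} => word w.1 := by
    ext f
    constructor
    · rintro ⟨w, hw, rfl⟩
      exact ⟨⟨w, hw⟩, rfl⟩
    · rintro ⟨w, rfl⟩
      exact ⟨w.1, w.2, rfl⟩
  rw [degLE, this, Submodule.mem_span_range_iff_exists_fun]

instance : FiniteDimensional ℝ (degLE g k) := by
  refine FiniteDimensional.span_of_finite ℝ
    (((List.finite_length_le (Fin g) k).image word).subset ?_)
  rintro _ ⟨w, hw, rfl⟩
  exact ⟨w, hw, rfl⟩

/-! ### Evaluation functionals. -/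

section Evaluation

variable {ι : Type*} [Fintype ι] [DecidableEq ι]

theorem lift_star {X : Fin g → Matrix ι ι ℝ} (hX : ∀ j, (X j).IsSymm) (f : NC g) :
    FreeAlgebra.lift ℝ X (star f) = (FreeAlgebra.lift ℝ X f)ᵀ := by
  induction f using FreeAlgebra.induction with
  | grade0 r => simp [Matrix.algebraMap_eq_diagonal]
  | grade1 j => simpa using (hX j).symm
  | mul a b ha hb => simp [ha, hb]
  | add a b ha hb => simp [ha, hb]

/-- The functional `P ↦ ⟨P(X)v, v⟩`. -/
def evalForm (X : Fin g → Matrix ι ι ℝ) (v : Fin m → ι → ℝ) : MatNC g m m →ₗ[ℝ] ℝ where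
  toFun P := ∑ a, ∑ b, v a ⬝ᵥ (FreeAlgebra.lift ℝ X (P a b) *ᵥ v b)
  map_add' P Q := by
    simp [Matrix.add_mulVec, dotProduct_add, Finset.sum_add_distrib]
  map_smul' c P := by
    simp [Matrix.smul_mulVec, Finset.mul_sum]

theorem evalForm_apply (X : Fin g → Matrix ι ι ℝ) (v : Fin m → ι → ℝ) (P : MatNC g m m) :
    evalForm X v P = ∑ a, ∑ b, v a ⬝ᵥ (FreeAlgebra.lift ℝ X (P a b) *ᵥ v b) := rfl

theorem evalForm_conjTranspose {X : Fin g → Matrix ι ι ℝ} (hX : ∀ j, (X j).IsSymm)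
    (v : Fin m → ι → ℝ) (P : MatNC g m m) : evalForm X v Pᴴ = evalForm X v P := by
  rw [evalForm_apply, evalForm_apply, Finset.sum_comm]
  refine Finset.sum_congr rfl fun a _ => Finset.sum_congr rfl fun b _ => ?_
  rw [Matrix.conjTranspose_apply, lift_star hX, Matrix.mulVec_transpose, dotProduct_comm,
    Matrix.dotProduct_mulVec]

/-- Moving `f(X)` onto the vector shows that an evaluation functional inherits positivity on `f^* Q
f` from `Q(X)`. -/
theorem evalForm_conj {X : Fin g → Matrix ι ι ℝ} (hX : ∀ j, (X j).IsSymm)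
    (v : Fin m → ι → ℝ) (Q : MatNC g l l) (f : MatNC g l m) :
    evalForm X v (fᴴ * Q * f)
      = evalForm X (fun c => ∑ a, FreeAlgebra.lift ℝ X (f c a) *ᵥ v a) Q := by
  have h : ∀ a b c c', v a ⬝ᵥ (FreeAlgebra.lift ℝ X (star (f c a) * Q c c' * f c' b) *ᵥ v b)
      = (FreeAlgebra.lift ℝ X (f c a) *ᵥ v a) ⬝ᵥ
        (FreeAlgebra.lift ℝ X (Q c c') *ᵥ (FreeAlgebra.lift ℝ X (f c' b) *ᵥ v b)) := by
    intro a b c c'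
    rw [map_mul, map_mul, lift_star hX, ← Matrix.mulVec_mulVec, ← Matrix.mulVec_mulVec,
      Matrix.dotProduct_mulVec, Matrix.vecMul_transpose]
  simp only [evalForm_apply, Matrix.mul_apply, Matrix.conjTranspose_apply, Finset.sum_mul, map_sum,
    Matrix.sum_mulVec, Matrix.mulVec_sum, dotProduct_sum, sum_dotProduct, h]
  rw [Finset.sum_congr rfl fun a _ => Finset.sum_congr rfl fun b _ => Finset.sum_comm]
  rw [Finset.sum_congr rfl fun a _ => Finset.sum_comm, Finset.sum_comm]
  refine Finset.sum_congr rfl fun c _ => ?_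
  rw [Finset.sum_congr rfl fun a _ => Finset.sum_comm, Finset.sum_comm]
  exact Finset.sum_congr rfl fun c' _ => Finset.sum_comm

theorem evalForm_one (X : Fin g → Matrix ι ι ℝ) (v : Fin m → ι → ℝ) :
    evalForm X v 1 = ∑ a, v a ⬝ᵥ v a := by
  rw [evalForm_apply]
  refine Finset.sum_congr rfl fun a _ => ?_
  rw [Finset.sum_eq_single a (fun b _ hb => by simp [Matrix.one_apply_ne hb.symm]) (by simp)]
  simp

theorem monicPencil_apply (A : Fin g → Matrix (Fin l) (Fin l) ℝ) (c c' : Fin l) :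
    monicPencil A c c' = (1 : MatNC g l l) c c' - ∑ j, A j c c' • FreeAlgebra.ι ℝ j := by
  simp [monicPencil, Matrix.sum_apply]

theorem isHermitian_monicPencil {A : Fin g → Matrix (Fin l) (Fin l) ℝ} (hA : ∀ j, (A j).IsSymm) :
    (monicPencil A).IsHermitian := by
  ext c c' : 2
  rw [Matrix.conjTranspose_apply, monicPencil_apply, monicPencil_apply, star_sub, star_sum,
    ← Matrix.conjTranspose_apply, Matrix.conjTranspose_one]
  simp [(hA _).apply]

theorem evalForm_monicPencil (A : Fin g → Matrix (Fin l) (Fin l) ℝ) (X : Fin g → Matrix ι ι ℝ)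
    (v : Fin l → ι → ℝ) : evalForm X v (monicPencil A)
      = ∑ c, v c ⬝ᵥ v c - ∑ j, ∑ c, ∑ c', A j c c' * (v c ⬝ᵥ (X j *ᵥ v c')) := by
  rw [monicPencil, map_sub, evalForm_one, map_sum]
  simp [evalForm_apply, Matrix.smul_mulVec]

end Evaluation

theorem dotProduct_evalAt_mulVec {n : ℕ} (P : MatNC g m m) (X : Fin g → Matrix (Fin n) (Fin n) ℝ)
    (x : Fin m × Fin n → ℝ) :
    x ⬝ᵥ (evalAt P X *ᵥ x) = evalForm X (fun a i => x (a, i)) P := by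
  simp [evalForm_apply, dotProduct, Matrix.mulVec, evalAt, Fintype.sum_prod_type, Finset.mul_sum]
  refine Finset.sum_congr rfl fun a _ => ?_
  rw [Finset.sum_comm]

theorem posSemidef_evalAt_iff {n : ℕ} {P : MatNC g m m} (hP : P.IsHermitian)
    {X : Fin g → Matrix (Fin n) (Fin n) ℝ} (hX : ∀ j, (X j).IsSymm) :
    (evalAt P X).PosSemidef ↔ ∀ v, 0 ≤ evalForm X v P := by
  rw [Matrix.posSemidef_iff_dotProduct_mulVec, and_iff_right]
  · simp only [star_trivial, dotProduct_evalAt_mulVec]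
    exact ⟨fun h v => h fun a => v a.1 a.2, fun h x => h _⟩
  · ext a b
    have h : star (P b.1 a.1) = P a.1 b.1 := hP.apply _ _
    simp [evalAt, ← h, lift_star hX]

/-! ### A strictly positive functional from the truncated Fock space. -/

/-- The sums of creation and annihilation operators on the span of the words of length at most
`k`, scaled by `ε`. -/
def fockMatrix (g k : ℕ) (ε : ℝ) (j : Fin g) :
    Matrix {w : List (Fin g) // w.length ≤ k} {w : List (Fin g) // w.length ≤ k} ℝ :=
  ε • Matrix.of fun u v => (if u.1 = j :: v.1 then 1 else 0) + (if v.1 = j :: u.1 then 1 else 0)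

/-- The vacuum vector. -/
def vacuum (g k : ℕ) : {w : List (Fin g) // w.length ≤ k} → ℝ :=
  fun u => if u.1 = [] then 1 else 0

theorem isSymm_fockMatrix (ε : ℝ) (j : Fin g) : (fockMatrix g k ε j).IsSymm := by
  ext u v
  simp [fockMatrix, add_comm]

/-- Applied to the vacuum, `w` gives `ε ^ |w|` times its own basis vector plus shorter words. In the
induction, annihilation into `u` would need a longer word than the tail can produce, so only
creation from the tail contributes. -/
theorem lift_fockMatrix_word (ε : ℝ) (w : List (Fin g)) (hw : w.length ≤ k)
    (u : {w : List (Fin g) // w.length ≤ k}) (hu : w.length ≤ u.1.length) :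
    (FreeAlgebra.lift ℝ (fockMatrix g k ε) (word w) *ᵥ vacuum g k) u
      = if u.1 = w then ε ^ w.length else 0 := by
  induction w generalizing u with
  | nil => simp [word_nil, vacuum]
  | cons j w ih =>
    have hw' : w.length ≤ k := (Nat.le_succ _).trans hw
    have hu' : w.length + 1 ≤ u.1.length := hu
    rw [word_cons, map_mul, FreeAlgebra.lift_ι_apply, ← Matrix.mulVec_mulVec, Matrix.mulVec,
      dotProduct, Finset.sum_eq_single (⟨w, hw'⟩ : {w : List (Fin g) // w.length ≤ k})]
    · have hne : w ≠ j :: u.1 := fun h => by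
        have := congrArg List.length h
        simp at this; omega
      rw [ih hw' _ le_rfl]
      by_cases h : u.1 = j :: w <;> simp [fockMatrix, h, hne, pow_succ']
      simp [← h, hne]
    · intro v _ hv
      have hvw : v.1 ≠ w := fun h => hv (Subtype.ext h)
      by_cases h1 : u.1 = j :: v.1
      · have := congrArg List.length h1
        rw [ih hw' v (by simp at this; omega)]
        simp [hvw]
      · by_cases h2 : v.1 = j :: u.1
        · have := congrArg List.length h2
          rw [ih hw' v (by simp at this; omega)]
          simp [hvw]
        · simp [fockMatrix, h1, h2]
    · simp

/-- The vacuum vector separates the polynomials of degree at most `k`. -/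
theorem lift_fockMatrix_mulVec_vacuum_ne_zero {ε : ℝ} (hε : ε ≠ 0) {f : NC g} (hf : f ∈ degLE g k)
    (hf0 : f ≠ 0) : FreeAlgebra.lift ℝ (fockMatrix g k ε) f *ᵥ vacuum g k ≠ 0 := by
  obtain ⟨c, rfl⟩ := mem_degLE_iff.mp hf
  have hne : (Finset.univ.filter fun w => c w ≠ 0).Nonempty := by
    by_contra h
    rw [Finset.not_nonempty_iff_eq_empty, Finset.filter_eq_empty_iff] at h
    exact hf0 (Finset.sum_eq_zero fun w hw => by simp [not_not.mp (h hw)])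
  -- At a longest word of `f`, no other word of `f` contributes to the coordinate.
  obtain ⟨w, hw, hmax⟩ := Finset.exists_max_image _ (fun w => w.1.length) hne
  intro h
  have h1 := congrFun h w
  rw [map_sum, Matrix.sum_mulVec, Finset.sum_apply, Finset.sum_eq_single w] at h1
  · rw [map_smul, Matrix.smul_mulVec, Pi.smul_apply, lift_fockMatrix_word ε w.1 w.2 w le_rfl] at h1
    simp [hε] at h1
    exact (Finset.mem_filter.mp hw).2 h1
  · intro v _ hv
    by_cases hcv : c v = 0
    · simp [hcv]
    · rw [map_smul, Matrix.smul_mulVec, Pi.smul_apply,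
        lift_fockMatrix_word ε v.1 v.2 w (hmax v (by simpa using hcv)),
        if_neg fun h => hv (Subtype.ext h.symm), smul_zero]
  · simp

/-- A monic linear pencil is bounded below by `1 / 2` at all small tuples. -/
theorem exists_evalForm_monicPencil_ge {ι : Type*} [Fintype ι] [DecidableEq ι]
    (A : Fin g → Matrix (Fin l) (Fin l) ℝ) (X : Fin g → Matrix ι ι ℝ) :
    ∃ ε : ℝ, 0 < ε ∧ ∀ v : Fin l → ι → ℝ,
      (∑ c, v c ⬝ᵥ v c) / 2 ≤ evalForm (fun j => ε • X j) v (monicPencil A) := by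
  set C := ∑ j, ∑ c, ∑ c', ∑ i, ∑ i', |A j c c'| * |X j i i'| with hC
  have hC0 : 0 ≤ C := by positivity
  -- The linear part is at most `ε * C * T`, hence at most `T / 2` for this `ε`; the `+ 1` covers `C
  -- = 0`.
  refine ⟨1 / (2 * (C + 1)), by positivity, fun v => ?_⟩
  set T := ∑ c, v c ⬝ᵥ v c with hT
  have hT0 : 0 ≤ T := Finset.sum_nonneg fun c _ => Finset.sum_nonneg fun i _ => mul_self_nonneg _
  have hle : ∀ c i, v c i ^ 2 ≤ T := fun c i => by
    rw [sq]
    exact (Finset.single_le_sum (f := fun i => v c i * v c i) (fun _ _ => mul_self_nonneg _)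
      (Finset.mem_univ i)).trans (Finset.single_le_sum (f := fun c => v c ⬝ᵥ v c)
        (fun c _ => Finset.sum_nonneg fun i _ => mul_self_nonneg _) (Finset.mem_univ c))
  have hab : ∀ c i c' i', |v c i * v c' i'| ≤ T := fun c i c' i' => by
    rw [abs_le]
    constructor <;> nlinarith [hle c i, hle c' i', sq_nonneg (v c i + v c' i'),
      sq_nonneg (v c i - v c' i')]
  have hS : ∑ j, ∑ c, ∑ c', A j c c' * (v c ⬝ᵥ (X j *ᵥ v c')) ≤ C * T := by
    simp only [hC, Finset.sum_mul, dotProduct, Matrix.mulVec, Finset.mul_sum]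
    refine Finset.sum_le_sum fun j _ => Finset.sum_le_sum fun c _ => Finset.sum_le_sum fun c' _ =>
      Finset.sum_le_sum fun i _ => Finset.sum_le_sum fun i' _ => ?_
    calc A j c c' * (v c i * (X j i i' * v c' i'))
        ≤ |A j c c' * (v c i * (X j i i' * v c' i'))| := le_abs_self _
      _ = |A j c c'| * |X j i i'| * |v c i * v c' i'| := by simp only [abs_mul]; ring
      _ ≤ _ := by gcongr; exact hab c i c' i'
  have hq : evalForm (fun j => (1 / (2 * (C + 1))) • X j) v (monicPencil A)
      = T - 1 / (2 * (C + 1)) * ∑ j, ∑ c, ∑ c', A j c c' * (v c ⬝ᵥ (X j *ᵥ v c')) := by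
    rw [evalForm_monicPencil]
    simp only [Matrix.smul_mulVec, dotProduct_smul, smul_eq_mul, Finset.mul_sum]
    congr 1
    refine Finset.sum_congr rfl fun j _ => Finset.sum_congr rfl fun c _ =>
      Finset.sum_congr rfl fun c' _ => by ring
  rw [hq]
  have h1 : 1 / (2 * (C + 1)) * ∑ j, ∑ c, ∑ c', A j c c' * (v c ⬝ᵥ (X j *ᵥ v c'))
      ≤ 1 / (2 * (C + 1)) * (C * T) := by gcongr
  have h2 : 1 / (2 * (C + 1)) * (C * T) ≤ T / 2 := by
    rw [div_mul_eq_mul_div, div_le_div_iff₀ (by positivity) (by norm_num)]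
    nlinarith
  linarith

/-- A functional which is strictly positive on squares and on weighted squares. -/
theorem exists_strictlyPositive (m k : ℕ) (A : Fin g → Matrix (Fin l) (Fin l) ℝ) :
    ∃ Λ : MatNC g m m →ₗ[ℝ] ℝ, (∀ p, Λ pᴴ = Λ p) ∧
      (∀ (r : ℕ) (s : MatNC g r m), HasDegLE k s → s ≠ 0 → 0 < Λ (sᴴ * s)) ∧
      ∀ f : MatNC g l m, HasDegLE k f → f ≠ 0 → 0 < Λ (fᴴ * monicPencil A * f) := by
  obtain ⟨ε, hε, hq⟩ := exists_evalForm_monicPencil_ge A (fockMatrix g k 1)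
  have hfock : (fun j => ε • fockMatrix g k 1 j) = fockMatrix g k ε := by
    ext j : 1; simp [fockMatrix]
  rw [hfock] at hq
  have hX : ∀ j, (fockMatrix g k ε j).IsSymm := isSymm_fockMatrix ε
  have hF : ∀ (r : ℕ) (s : MatNC g r m) (a : Fin m), (fun c => ∑ b,
      FreeAlgebra.lift ℝ (fockMatrix g k ε) (s c b) *ᵥ
        (Pi.single a (vacuum g k) : Fin m → _ → ℝ) b)
      = fun c => FreeAlgebra.lift ℝ (fockMatrix g k ε) (s c a) *ᵥ vacuum g k := by
    intro r s a
    ext c : 1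
    rw [Finset.sum_eq_single a (fun b _ hb => by simp [Pi.single_eq_of_ne hb]) (by simp)]
    simp
  have hpos : ∀ (r : ℕ) (s : MatNC g r m), HasDegLE k s → s ≠ 0 →
      0 < ∑ a, ∑ c, (FreeAlgebra.lift ℝ (fockMatrix g k ε) (s c a) *ᵥ vacuum g k) ⬝ᵥ
        (FreeAlgebra.lift ℝ (fockMatrix g k ε) (s c a) *ᵥ vacuum g k) := by
    intro r s hs hs0
    have hnn : ∀ x : {w : List (Fin g) // w.length ≤ k} → ℝ, 0 ≤ x ⬝ᵥ x := fun x =>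
      Finset.sum_nonneg fun i _ => mul_self_nonneg _
    obtain ⟨c, a, hca⟩ : ∃ c a, s c a ≠ 0 := by
      by_contra! h
      exact hs0 (Matrix.ext h)
    refine Finset.sum_pos' (fun a _ => Finset.sum_nonneg fun c _ => hnn _)
      ⟨a, Finset.mem_univ a, Finset.sum_pos' (fun c _ => hnn _) ⟨c, Finset.mem_univ c,
        (hnn _).lt_of_ne' fun h => ?_⟩⟩
    exact lift_fockMatrix_mulVec_vacuum_ne_zero hε.ne' (hs c a) hca (dotProduct_self_eq_zero.mp h)
  -- Placing the vacuum in each slot `a` in turn detects every column of `s`.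
  refine ⟨∑ a, evalForm (fockMatrix g k ε) (Pi.single a (vacuum g k)), fun p => ?_,
    fun r s hs hs0 => ?_, fun f hf hf0 => ?_⟩
  · simp only [LinearMap.sum_apply, evalForm_conjTranspose hX]
  · rw [← Matrix.mul_one sᴴ]
    simp only [LinearMap.sum_apply, evalForm_conj hX, hF, evalForm_one]
    exact hpos r s hs hs0
  · simp only [LinearMap.sum_apply, evalForm_conj hX, hF]
    refine (half_pos (hpos l f hf hf0)).trans_le ?_
    rw [Finset.sum_div]
    exact Finset.sum_le_sum fun a _ => hq _

/-! ### The truncated GNS construction. -/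

theorem exists_orthonormal_basis_of_symm_of_pos {H : Type*} [AddCommGroup H] [Module ℝ H]
    [FiniteDimensional ℝ H] {N : ℕ} (hN : Module.finrank ℝ H = N) (β : H →ₗ[ℝ] H →ₗ[ℝ] ℝ) (hsymm : ∀ x y, β x y = β y x)
    (hpos : ∀ x, x ≠ 0 → 0 < β x x) :
    ∃ e : Fin N → H,
      (∀ i j, β (e i) (e j) = if i = j then 1 else 0) ∧ ∀ x, ∑ i, β (e i) x • e i = x := by
  subst hN
  obtain ⟨v, hv⟩ := LinearMap.BilinForm.exists_orthogonal_basis (B := β) ⟨fun x y => hsymm x y⟩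
  have hv0 : ∀ i, 0 < β (v i) (v i) := fun i => hpos _ (v.ne_zero i)
  refine ⟨fun i => (√(β (v i) (v i)))⁻¹ • v i, fun i j => ?_, fun x => ?_⟩
  · rw [map_smul, map_smul, LinearMap.smul_apply, smul_eq_mul, smul_eq_mul]
    split_ifs with hij
    · subst hij
      have h1 := Real.mul_self_sqrt (hv0 i).le
      have h2 := (Real.sqrt_pos.mpr (hv0 i)).ne'
      generalize √(β (v i) (v i)) = t at *
      rw [← h1]
      field_simp
    · rw [show β (v i) (v j) = 0 from hv hij, mul_zero, mul_zero]
  have h : ∀ i, β (v i) x = v.repr x i * β (v i) (v i) := fun i => by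
    conv_lhs => rw [← v.sum_repr x]
    rw [map_sum, Finset.sum_eq_single i]
    · simp
    · intro j _ hj
      rw [map_smul, show β (v i) (v j) = 0 from hv hj.symm, smul_zero]
    · simp
  conv_rhs => rw [← v.sum_repr x]
  refine Finset.sum_congr rfl fun i _ => ?_
  rw [map_smul, LinearMap.smul_apply, smul_eq_mul, smul_smul, h]
  congr 1
  have h1 := Real.mul_self_sqrt (hv0 i).le
  have h2 := (Real.sqrt_pos.mpr (hv0 i)).ne'
  generalize √(β (v i) (v i)) = t at *
  rw [← h1]
  field_simp

/-- The trilinear form `(u, t, v) ↦ L (u^* t v)` for rows `u`, `v` and a polynomial `t`. -/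
noncomputable def sandwich (L : MatNC g m m →ₗ[ℝ] ℝ) :
    (Fin m → NC g) →ₗ[ℝ] NC g →ₗ[ℝ] (Fin m → NC g) →ₗ[ℝ] ℝ :=
  LinearMap.mk₂ ℝ
    (fun u t =>
      { toFun := fun v => L (Matrix.of fun a b => star (u a) * t * v b)
        map_add' := fun v w => by
          rw [← map_add]; congr 1; ext a b : 2; simp [mul_add]
        map_smul' := fun c v => by
          rw [← map_smul]; congr 1; ext a b : 2; simp })
    (fun u u' t => LinearMap.ext fun v => by
      simp only [LinearMap.coe_mk, AddHom.coe_mk, LinearMap.add_apply]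
      rw [← map_add]; congr 1; ext a b : 2; simp [add_mul])
    (fun c u t => LinearMap.ext fun v => by
      simp only [LinearMap.coe_mk, AddHom.coe_mk, LinearMap.smul_apply]
      rw [← map_smul]; congr 1; ext a b : 2; simp)
    (fun u t t' => LinearMap.ext fun v => by
      simp only [LinearMap.coe_mk, AddHom.coe_mk, LinearMap.add_apply]
      rw [← map_add]; congr 1; ext a b : 2; simp [add_mul, mul_add])
    (fun c u t => LinearMap.ext fun v => by
      simp only [LinearMap.coe_mk, AddHom.coe_mk, LinearMap.smul_apply]
      rw [← map_smul]; congr 1; ext a b : 2; simp)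

theorem sandwich_apply (L : MatNC g m m →ₗ[ℝ] ℝ) (u : Fin m → NC g) (t : NC g)
    (v : Fin m → NC g) :
    sandwich L u t v = L (Matrix.of fun a b => star (u a) * t * v b) := rfl

theorem sandwich_smul_right (L : MatNC g m m →ₗ[ℝ] ℝ) (u : Fin m → NC g) (t z : NC g)
    (v : Fin m → NC g) : sandwich L u t (z • v) = sandwich L u (t * z) v := by
  simp only [sandwich_apply, Pi.smul_apply, smul_eq_mul, mul_assoc]

theorem sandwich_symm {L : MatNC g m m →ₗ[ℝ] ℝ} (hL : ∀ p, L pᴴ = L p) (u : Fin m → NC g)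
    (t : NC g) (v : Fin m → NC g) : sandwich L u t v = sandwich L v (star t) u := by
  rw [sandwich_apply, sandwich_apply, ← hL]
  congr 1
  ext a b : 2
  simp [mul_assoc]

theorem sum_sandwich_single (L : MatNC g m m →ₗ[ℝ] ℝ) (p : MatNC g m m) :
    ∑ a, ∑ b, sandwich L (Pi.single a 1) (p a b) (Pi.single b 1) = L p := by
  simp only [sandwich_apply, ← map_sum]
  congr 1
  ext a b : 2
  simp only [Matrix.sum_apply, Matrix.of_apply]
  rw [Finset.sum_eq_single a, Finset.sum_eq_single b]
  · simp
  · intro b' _ hb; simp [Pi.single_eq_of_ne hb.symm]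
  · simp
  · intro a' _ ha; simp [Pi.single_eq_of_ne ha.symm]
  · simp

theorem sum_sandwich_eq (L : MatNC g m m →ₗ[ℝ] ℝ) (Q : MatNC g l l) (f : MatNC g l m) :
    ∑ c, ∑ c', sandwich L (f c) (Q c c') (f c') = L (fᴴ * Q * f) := by
  simp only [sandwich_apply, ← map_sum]
  congr 1
  ext a b : 2
  simp only [Matrix.sum_apply, Matrix.of_apply, Matrix.mul_apply, Matrix.conjTranspose_apply,
    Finset.sum_mul]
  exact Finset.sum_comm

/-- The truncated Gelfand–Naimark–Segal construction. -/
theorem exists_evalForm_eq {A : Fin g → Matrix (Fin l) (Fin l) ℝ} (hA : ∀ j, (A j).IsSymm)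
    (L : MatNC g m m →ₗ[ℝ] ℝ) (hL : ∀ p, L pᴴ = L p)
    (hpos : ∀ s : MatNC g 1 m, HasDegLE k s → s ≠ 0 → 0 < L (sᴴ * s))
    (hq : ∀ f : MatNC g l m, HasDegLE k f → 0 ≤ L (fᴴ * monicPencil A * f)) :
    ∃ Y ∈ posSet (monicPencil A) (m * Module.finrank ℝ (degLE g k)), ∃ v,
      ∀ p : MatNC g m m, HasDegLE (2 * k + 1) p → evalForm Y v p = L p := by
  have hdim : Module.finrank ℝ (Fin m → degLE g k) = m * Module.finrank ℝ (degLE g k) := by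
    simp [Module.finrank_pi_fintype]
  generalize m * Module.finrank ℝ (degLE g k) = N at *
  let inc := (degLE g k).subtype.compLeft (Fin m)
  have hinc : ∀ h a, inc h a = (h a : NC g) := fun _ _ => rfl
  let β : (Fin m → degLE g k) →ₗ[ℝ] (Fin m → degLE g k) →ₗ[ℝ] ℝ :=
    (((sandwich L).flip 1).comp inc).compl₂ inc
  have hβ : ∀ x y, β x y = sandwich L (inc x) 1 (inc y) := fun _ _ => rfl
  obtain ⟨e, hortho, he⟩ := exists_orthonormal_basis_of_symm_of_pos hdim β
    (fun x y => by rw [hβ, hβ, sandwich_symm hL, star_one])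
    (fun x hx => by
      have h1 := hpos (Matrix.of fun _ a => (x a : NC g)) (fun _ a => (x a).2) (fun h => hx (by
        ext a
        exact congrFun (congrFun h 0) a))
      convert h1 using 1
      rw [hβ, sandwich_apply]
      congr 1
      ext a b : 2
      simp [Matrix.mul_apply, hinc])
  let u : Fin N → Fin m → NC g := fun i => inc (e i)
  -- Resolution of the identity: a sum over the orthonormal basis may be inserted between `y` and
  -- `z` as soon as `z • w` lies in the truncated space. `resolution'` is the adjoint version.
  have resolution : ∀ (x : Fin m → NC g) (y z : NC g) (w : Fin m → NC g), (∃ h, inc h = z • w) →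
      ∑ i, sandwich L x y (u i) * sandwich L (u i) z w = sandwich L x (y * z) w := by
    rintro x y z w ⟨h, hh⟩
    rw [← sandwich_smul_right, ← hh]
    conv_rhs => rw [← he h]
    rw [map_sum, map_sum]
    refine Finset.sum_congr rfl fun i _ => ?_
    rw [map_smul, map_smul, hβ, hh, sandwich_smul_right, one_mul, smul_eq_mul, mul_comm]
  have resolution' : ∀ (x : Fin m → NC g) (y z : NC g) (w : Fin m → NC g),
      (∃ h, inc h = star y • x) →
      ∑ i, sandwich L x y (u i) * sandwich L (u i) z w = sandwich L x (y * z) w := by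
    intro x y z w h
    rw [sandwich_symm hL x, star_mul, ← resolution w (star z) (star y) x h]
    refine Finset.sum_congr rfl fun i _ => ?_
    rw [sandwich_symm hL x, sandwich_symm hL (u i) z, mul_comm]
  have hword : ∀ (a : Fin m) (w : List (Fin g)), w.length ≤ k →
      ∃ h, inc h = word w • (Pi.single a 1 : Fin m → NC g) := by
    intro a w hw
    refine ⟨Pi.single a ⟨word w, word_mem_degLE hw⟩, ?_⟩
    ext b : 1
    rcases eq_or_ne b a with rfl | hb
    · simp [hinc]
    · simp [hinc, Pi.single_eq_of_ne hb]
  let Y : Fin g → Matrix (Fin N) (Fin N) ℝ := fun j =>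
    Matrix.of fun i i' => sandwich L (u i) (FreeAlgebra.ι ℝ j) (u i')
  have hY : ∀ j, (Y j).IsSymm := fun j => by
    ext i i'
    simp only [Y, Matrix.transpose_apply, Matrix.of_apply]
    rw [sandwich_symm hL, FreeAlgebra.star_ι]
  let v : Fin m → Fin N → ℝ := fun a i => sandwich L (u i) 1 (Pi.single a 1)
  -- Length `k + 1` is allowed because only the tail after the first letter must lie in the space;
  -- the result is just paired with `u i`.
  have hvec : ∀ (a : Fin m) (w : List (Fin g)), w.length ≤ k + 1 → ∀ i,
      (FreeAlgebra.lift ℝ Y (word w) *ᵥ v a) i = sandwich L (u i) (word w) (Pi.single a 1) := by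
    intro a w
    induction w with
    | nil => intro _ i; simp [word_nil, v]
    | cons j w ih =>
      intro hw i
      have hw' : w.length ≤ k := by simpa using hw
      rw [word_cons, map_mul, FreeAlgebra.lift_ι_apply, ← Matrix.mulVec_mulVec, Matrix.mulVec,
        dotProduct, ← resolution _ _ _ _ (hword a w hw')]
      exact Finset.sum_congr rfl fun i' _ => by rw [ih (by omega)]; rfl
  have hmoment : ∀ (a b : Fin m) (w : List (Fin g)), w.length ≤ 2 * k + 1 →
      v a ⬝ᵥ (FreeAlgebra.lift ℝ Y (word w) *ᵥ v b)
        = sandwich L (Pi.single a 1) (word w) (Pi.single b 1) := by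
    intro a b w hw
    -- The first `k` letters act on the left vector, the remaining at most `k + 1` on the right one.
    have h1 : (w.take k).length ≤ k := by simp
    have h2 : (w.drop k).length ≤ k + 1 := by simp; omega
    rw [← List.take_append_drop k w, word_append]
    generalize w.take k = w₁ at *
    generalize w.drop k = w₂ at *
    rw [← resolution' _ _ _ _ (by
      rw [star_word]; exact hword a _ (by simpa using h1)), map_mul, ← Matrix.mulVec_mulVec,
      Matrix.dotProduct_mulVec, ← Matrix.mulVec_transpose, ← lift_star hY, dotProduct]
    refine Finset.sum_congr rfl fun i _ => ?_
    rw [hvec b w₂ h2, star_word, hvec a _ (by simp; omega), sandwich_symm hL (u i) (word w₁.reverse),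
      star_word, List.reverse_reverse]
  refine ⟨Y, ⟨hY, ?_⟩, v, fun p hp => ?_⟩
  · rw [posSemidef_evalAt_iff (isHermitian_monicPencil hA) hY]
    intro x
    have hentry : ∀ (c c' : Fin l) (i i' : Fin N), FreeAlgebra.lift ℝ Y (monicPencil A c c') i i'
        = sandwich L (u i) (monicPencil A c c') (u i') := by
      intro c c' i i'
      have hone : (1 : Matrix (Fin N) (Fin N) ℝ) i i' = sandwich L (u i) 1 (u i') := by
        rw [Matrix.one_apply, ← hortho]; rfl
      rw [monicPencil_apply, map_sub, map_sub, map_sum, map_sum, Matrix.sub_apply,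
        Matrix.sum_apply, LinearMap.sub_apply, LinearMap.sum_apply]
      congr 1
      · rcases eq_or_ne c c' with rfl | h
        · simp [hone]
        · simp [Matrix.one_apply_ne h]
      · refine Finset.sum_congr rfl fun j _ => ?_
        simp [Y]
    -- The vector `x` encodes the coordinates of the rows of this `f`, and `⟨q(Y) x, x⟩ = L(f^* q
    -- f)`.
    have h1 := hq (Matrix.of fun c a => ∑ i, x c i • u i a)
      (fun c a => by
        rw [Matrix.of_apply]
        exact Submodule.sum_mem _ fun i _ => Submodule.smul_mem _ _ (e i a).2)
    convert h1 using 1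
    have hrow : ∀ c, (Matrix.of fun c a => ∑ i, x c i • u i a : MatNC g l m) c
        = ∑ i, x c i • u i := fun c => by
      ext a : 1
      simp
    rw [← sum_sandwich_eq, evalForm_apply]
    refine Finset.sum_congr rfl fun c _ => Finset.sum_congr rfl fun c' _ => ?_
    simp only [hrow, map_sum, map_smul, LinearMap.sum_apply, LinearMap.smul_apply, smul_eq_mul,
      dotProduct, Matrix.mulVec, Finset.mul_sum, hentry]
    rw [Finset.sum_comm]
    exact Finset.sum_congr rfl fun i _ => Finset.sum_congr rfl fun i' _ => by ring
  · rw [← sum_sandwich_single L, evalForm_apply]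
    refine Finset.sum_congr rfl fun a _ => Finset.sum_congr rfl fun b _ => ?_
    obtain ⟨c, hc⟩ := mem_degLE_iff.mp (hp a b)
    simp only [← hc, map_sum, map_smul, Matrix.sum_mulVec, dotProduct_sum, LinearMap.sum_apply,
      LinearMap.smul_apply, Matrix.smul_mulVec, dotProduct_smul]
    exact Finset.sum_congr rfl fun w _ => by rw [hmoment a b w.1 w.2]

/-! ### The Positivstellensatz and the test rank bound. -/

theorem hasPosSs_monicPencil (hm : 0 < m) (d : ℕ) {A : Fin g → Matrix (Fin l) (Fin l) ℝ}
    (hA : ∀ j, (A j).IsSymm) : HasPosSs (monicPencil A) m (d + 1) d (2 * d + 1) := by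
  intro p hp hdeg hpsd
  by_contra hmem
  -- Squares of degree `d` rather than `d + 1` already suffice here.
  let cs := (degLE g d).subtype.mapMatrix (m := Fin m) (n := Fin m)
  let cf := (degLE g d).subtype.mapMatrix (m := Fin l) (n := Fin m)
  let B : (Matrix (Fin m) (Fin m) (degLE g d) × Matrix (Fin l) (Fin m) (degLE g d)) →ₗ[ℝ]
      (Matrix (Fin m) (Fin m) (degLE g d) × Matrix (Fin l) (Fin m) (degLE g d)) →ₗ[ℝ]
        MatNC g m m :=
    LinearMap.mk₂ ℝ (fun x y => (cs x.1)ᴴ * cs y.1 + (cf x.2)ᴴ * monicPencil A * cf y.2)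
      (fun x x' y => by
        simp only [Prod.fst_add, Prod.snd_add, map_add, Matrix.conjTranspose_add, Matrix.add_mul]
        abel)
      (fun c x y => by
        simp only [Prod.smul_fst, Prod.smul_snd, map_smul, Matrix.conjTranspose_smul,
          Matrix.smul_mul, star_trivial, smul_add])
      (fun x y y' => by
        simp only [Prod.fst_add, Prod.snd_add, map_add, Matrix.mul_add]
        abel)
      (fun c x y => by
        simp only [Prod.smul_fst, Prod.smul_snd, map_smul, Matrix.mul_smul, smul_add])
  have hB : ∀ x, B x x = (cs x.1)ᴴ * cs x.1 + (cf x.2)ᴴ * monicPencil A * cf x.2 := fun _ => rfl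
  have hcs : ∀ s, HasDegLE d (cs s) := fun s i j => (s i j).2
  have hcf : ∀ f, HasDegLE d (cf f) := fun f i j => (f i j).2
  have hcs0 : ∀ s, cs s = 0 → s = 0 := fun s h => Matrix.ext fun i j =>
    Subtype.ext (congrFun (congrFun h i) j)
  have hcf0 : ∀ f, cf f = 0 → f = 0 := fun f h => Matrix.ext fun i j =>
    Subtype.ext (congrFun (congrFun h i) j)
  obtain ⟨Λ, -, hΛs, hΛf⟩ := exists_strictlyPositive m d A
  obtain ⟨L, hLp, hL⟩ := exists_separating_of_forall_ne_sum B Λ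
    (fun x hx => by
      rw [hB, map_add]
      have h1 : 0 ≤ Λ ((cs x.1)ᴴ * cs x.1) := by
        rcases eq_or_ne (cs x.1) 0 with h | h
        · simp [h]
        · exact (hΛs m _ (hcs _) h).le
      have h2 : 0 ≤ Λ ((cf x.2)ᴴ * monicPencil A * cf x.2) := by
        rcases eq_or_ne (cf x.2) 0 with h | h
        · simp [h]
        · exact (hΛf _ (hcf _) h).le
      by_cases hs : cs x.1 = 0
      · have hf : cf x.2 ≠ 0 := fun hf => hx (Prod.ext (hcs0 _ hs) (hcf0 _ hf))
        exact add_pos_of_nonneg_of_pos h1 (hΛf _ (hcf _) hf)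
      · exact add_pos_of_pos_of_nonneg (hΛs m _ (hcs _) hs) h2)
    p (fun R hR => hmem ⟨_, ⟨_, fun i => cs (R i).1, fun i => (hcs _).mono (Nat.le_succ d), rfl⟩,
      _, ⟨_, fun i => cf (R i).2, fun i => hcf _, rfl⟩,
      by rw [hR, ← Finset.sum_add_distrib]; rfl⟩)
  -- The separating functional need not be symmetric; symmetrizing only doubles it on Hermitian
  -- elements.
  let L' : MatNC g m m →ₗ[ℝ] ℝ := L + L ∘ₗ
    { toFun := fun p => pᴴ
      map_add' := Matrix.conjTranspose_add
      map_smul' := fun c p => by simp [Matrix.conjTranspose_smul] }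
  have hL' : ∀ p, L' p = L p + L pᴴ := fun _ => rfl
  have hLherm : ∀ p : MatNC g m m, p.IsHermitian → L' p = 2 * L p := fun p hp => by
    rw [hL', hp.eq, two_mul]
  obtain ⟨Y, hY, v, hv⟩ := exists_evalForm_eq (k := d) hA L'
    (fun p => by rw [hL', hL', Matrix.conjTranspose_conjTranspose, add_comm])
    (fun s hs hs0 => by
      -- Repeating the row `s` in all `m` rows makes it a square matrix whose square is `m • (sᴴ *
      -- s)`.
      have hne : (Matrix.of fun _ a => ⟨s 0 a, hs 0 a⟩ : Matrix (Fin m) (Fin m) (degLE g d)) ≠ 0 :=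
        fun h => hs0 (by
          ext i a : 2
          rw [Subsingleton.elim i 0]
          exact congrArg Subtype.val (congrFun (congrFun h ⟨0, hm⟩) a))
      have h1 := hL (Matrix.of fun _ a => ⟨s 0 a, hs 0 a⟩, 0) fun h => hne (congrArg Prod.fst h)
      have h2 : B (Matrix.of fun _ a => ⟨s 0 a, hs 0 a⟩, 0)
          (Matrix.of fun _ a => ⟨s 0 a, hs 0 a⟩, 0) = (m : ℝ) • (sᴴ * s) := by
        rw [hB]
        ext a b : 2
        simp [cs, Matrix.mul_apply, Nat.cast_smul_eq_nsmul]
      rw [h2, map_smul, smul_eq_mul] at h1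
      rw [hLherm _ (Matrix.isHermitian_conjTranspose_mul_self s)]
      have := pos_of_mul_pos_right h1 (Nat.cast_nonneg m)
      positivity)
    (fun f hf => by
      rw [hLherm _ (Matrix.isHermitian_conjTranspose_mul_mul f (isHermitian_monicPencil hA))]
      have h2 : B (0, Matrix.of fun c a => ⟨f c a, hf c a⟩)
          (0, Matrix.of fun c a => ⟨f c a, hf c a⟩) = fᴴ * monicPencil A * f := by
        rw [hB, map_zero, Matrix.mul_zero, zero_add]
        rfl
      rw [← h2]
      rcases eq_or_ne (0, Matrix.of fun c a => ⟨f c a, hf c a⟩) (0 : Matrix (Fin m) (Fin m)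
        (degLE g d) × Matrix (Fin l) (Fin m) (degLE g d)) with h | h
      · simp [h]
      · have := hL _ h
        positivity)
  have h1 := (posSemidef_evalAt_iff hp hY.1).mp (hpsd _ Y hY) v
  rw [hv p hdeg, hLherm p hp] at h1
  linarith

theorem isTestSize_monicPencil (m d : ℕ) {A : Fin g → Matrix (Fin l) (Fin l) ℝ}
    (hA : ∀ j, (A j).IsSymm) :
    IsTestSize (monicPencil A) (2 * d + 2) m (m * Module.finrank ℝ (degLE g (d + 1))) := by
  refine fun p hp hdeg => ⟨fun h => h _, fun h n X hX => ?_⟩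
  rw [posSemidef_evalAt_iff hp hX.1]
  intro v
  by_contra! hneg
  obtain ⟨Λ, hΛ, hΛs, hΛf⟩ := exists_strictlyPositive m (d + 1) A
  -- Evaluation at `(X, v)` may be degenerate. Adding `δ • Λ` makes it strictly positive on squares,
  -- with `δ` small enough to keep the value at `p` negative.
  set δ := -evalForm X v p / (2 * (|Λ p| + 1))
  have hδ : 0 < δ := div_pos (by linarith) (by positivity)
  have hδp : δ * (|Λ p| + 1) = -evalForm X v p / 2 := by
    simp only [δ]
    field_simp
  have hqX := (posSemidef_evalAt_iff (isHermitian_monicPencil hA) hX.1).mp hX.2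
  obtain ⟨Y, hY, w, hw⟩ := exists_evalForm_eq (k := d + 1) hA (evalForm X v + δ • Λ)
    (fun p => by simp [evalForm_conjTranspose hX.1, hΛ])
    (fun s hs hs0 => by
      refine add_pos_of_nonneg_of_pos ?_ (mul_pos hδ (hΛs _ s hs hs0))
      rw [← Matrix.mul_one sᴴ, evalForm_conj hX.1, evalForm_one]
      exact Finset.sum_nonneg fun c _ => Finset.sum_nonneg fun i _ => mul_self_nonneg _)
    (fun f hf => by
      refine add_nonneg ?_ (mul_nonneg hδ.le ?_)
      · rw [evalForm_conj hX.1]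
        exact hqX _
      · rcases eq_or_ne f 0 with rfl | hf0
        · simp
        · exact (hΛf f hf hf0).le)
  have h1 := (posSemidef_evalAt_iff hp hY.1).mp (h Y hY) w
  rw [hw p fun i j => degLE_mono (by omega) (hdeg i j)] at h1
  simp only [LinearMap.add_apply, LinearMap.smul_apply, smul_eq_mul] at h1
  nlinarith [le_abs_self (Λ p)]

theorem finrank_degLE_pos (g k : ℕ) : 0 < Module.finrank ℝ (degLE g k) := by
  have : Nontrivial (degLE g k) := by
    refine ⟨⟨⟨1, ?_⟩, 0, fun h => one_ne_zero (congrArg Subtype.val h)⟩⟩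
    exact word_mem_degLE (w := []) (Nat.zero_le k)
  exact Module.finrank_pos

end NCPoly

theorem proposition2p4 (g l m d : ℕ) (hg : 0 < g) (hl : 0 < l) (hm : 0 < m)
    (q : NCPoly.MatNC g l l) (hq : NCPoly.IsMonicLinearPencil q) :
    NCPoly.HasPosSs q m (d + 1) d (2 * d + 1) ∧
      ∃ t : ℕ, NCPoly.IsTestRank q (2 * d + 2) m t ∧
        t ≤ m * Module.finrank ℝ (NCPoly.degLE g (d + 1)) := by
  classical
  obtain ⟨A, hA, rfl⟩ := hq
  refine ⟨NCPoly.hasPosSs_monicPencil hm d hA, ?_⟩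
  have hN : ∃ t, 0 < t ∧ NCPoly.IsTestSize (NCPoly.monicPencil A) (2 * d + 2) m t :=
    ⟨_, Nat.mul_pos hm (NCPoly.finrank_degLE_pos g (d + 1)), NCPoly.isTestSize_monicPencil m d hA⟩
  exact ⟨Nat.find hN, ⟨Nat.find_spec hN, fun t ht => Nat.find_min' hN ht⟩, Nat.find_min' hN
    ⟨Nat.mul_pos hm (NCPoly.finrank_degLE_pos g (d + 1)), NCPoly.isTestSize_monicPencil m d hA⟩⟩
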